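/- **Conventions.** For $n\ge 0$ and $p\in[0,1]$, the directed Erdős–Rényi model $\vec G(n,p)$ is the random digraph on $n$ labelled nodes, without loops, in which each of the $n(n-1)$ possible directed edges is present independently with probability $p$; a given simple digraph with $m$ edges thus has probability $p^m(1-p)^{n(n-1)-m}$. An event holds with high probability (w.h.p.) if its probability tends to $1$ as $n\to\infty$. As $n \to\infty$, $f=o(g)$ means $f/g\to0$, $f=\omega(g)$ means $g/f\to 0$, and $f\sim g$ means $f/g\to1$. For a simple digraph $G=(V,E)$ let $\Lambda_k$ be the free $\mathbb Z$-module on all sequences $v_0\cdots v_k$ in $V$ ($k\ge0$), let $\Lambda_{-1}=\mathbb Z$, let $\mathcal A_k\subseteq\Lambda_k$ be spanned by the sequences with $(v_i,v_{i+1})\in E$ for all $i$, and let $\mathcal A_{-1}=\mathbb Z$. Put $\partial_k e_{v_0\cdots v_k}=\sum_{i=0}^k(-1)^i e_{v_0\cdots\hat v_i\cdots v_k}$ for $k\ge1$ and $\partial_0e_v=1$, and let $\partial_k^{\mathrm{reg}}=\pi\circ\partial_k$, where $\pi$ sends to $0$ every sequence with two equal consecutive entries and fixes all other sequences. With $\Omega_k=\{v\in\mathcal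 A_k:\partial_kv\in\mathcal A_{k-1}\}$, the first Betti number of non-regular path homology is $$\beta_1(G)=\operatorname{rank}\bigl(\ker(\partial_1|_{\Omega_1})/\partial_2(\Omega_2)\bigr).$$ The first Betti number of regular path homology is defined in the same way with $\partial^{\mathrm{reg}}$ in place of $\partial$. **Theorem.** Let $\beta_1$ be the first Betti number of either non-regular or regular path homology, and let $G\sim\vec G(n,p(n))$. 1. Suppose that $p(n)=n^\alpha$ for all $n \ge 1$. (a) If $-1<\alpha<-2/3$, then $\mathbb E[\beta_1(G)]\sim n(n-1)p(n)$. (b) If $-1<\alpha<-2/3$, then $\beta_1(G)>0$ w.h.p. (c) If $\alpha<-1$, then $\beta_1(G)=0$ w.h.p. (d) If $-1/3<\alpha\le0$, then $\beta_1(G)=0$ w.h.p. 2. More generally, let $p(n)\in[0,1]$ for all $n$. (a) If $p=\omega(n^{-1})$ and $p=o(n^{-2/3})$, then $\mathbb E[\beta_1(G)]\sim n(n-1)p(n)$ and $\beta_1(G)>0$ w.h.p. (b) If $p=o(n^{-1})$, then $\beta_1(G)=0$ w.h.p. (c) If $p=\omega\bigl((n/\log n)^{-1/3}\bigr)$, then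 $\beta_1(G)=0$ w.h.p. -/

import Mathlib

open Filter Topology Asymptotics

noncomputable section

/-- The two flavours of path homology of a digraph. -/
inductive PathFlavour
  | nonregular
  | regular

namespace PathHomology

variable (R : Type*) [CommRing R] (V : Type*)

/-- The free `R`-module on all sequences of `m` vertices. Chains are indexed here by the number of
vertices, not by the degree: the elementary `p`-paths `v₀ ⋯ v_p` are the sequences with
`m = p + 1` entries, so that `Λ_p` is `Chain R V (p + 1)`. For `m = 0` there is exactly one
sequence (the empty one), and `Chain R V 0` is a copy of `R`, which is the convention
`Λ_{-1} = R`. -/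
abbrev Chain (m : ℕ) : Type _ := (Fin m → V) →₀ R

variable {V}

/-- A sequence of vertices is regular if no two consecutive entries are equal. -/
def IsRegularPath {m : ℕ} (v : Fin m → V) : Prop :=
  ∀ i j : Fin m, (i : ℕ) + 1 = j → v i ≠ v j

/-- A sequence of vertices is allowed in `G` if consecutive entries are joined by an edge of `G`. -/
def IsAllowedPath (G : Digraph V) {m : ℕ} (v : Fin m → V) : Prop :=
  ∀ i j : Fin m, (i : ℕ) + 1 = j → G.Adj (v i) (v j)

variable (V)

/-- The non-regular boundary `∂ : Λ_p → Λ_{p-1}` (with `p = m`),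
`e_{v₀ ⋯ v_p} ↦ ∑ i, (-1)^i e_{v₀ ⋯ v̂ᵢ ⋯ v_p}`. For `m = 0` this is the augmentation
`e_v ↦ 1`, as `Chain R V 0` is spanned by the empty sequence. -/
def nonregularBoundary (m : ℕ) : Chain R V (m + 1) →ₗ[R] Chain R V m :=
  Finsupp.linearCombination R fun v : Fin (m + 1) → V =>
    ∑ i : Fin (m + 1), (-1 : R) ^ (i : ℕ) • Finsupp.single (fun j : Fin m => v (i.succAbove j)) 1

open Classical in
/-- The projection `π` that fixes the regular paths and sends every irregular path to `0`. -/
def regularProjection (m : ℕ) : Chain R V m →ₗ[R] Chain R V m :=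
  Finsupp.linearCombination R fun v : Fin m → V =>
    if IsRegularPath v then Finsupp.single v (1 : R) else 0

/-- The boundary operator of each flavour: `∂`, respectively `π ∘ ∂`. (The regular operator is
usually restricted to combinations of regular paths; below it is only applied to combinations of
allowed paths, which are regular in a digraph without loops.) -/
def boundary (F : PathFlavour) (m : ℕ) : Chain R V (m + 1) →ₗ[R] Chain R V m :=
  match F with
  | .nonregular => nonregularBoundary R V m
  | .regular => regularProjection R V m ∘ₗ nonregularBoundary R V m

variable {V}

/-- The submodule spanned by the allowed paths with `m` vertices, i.e. `𝒜_{m-1}`. -/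
def allowedChains (G : Digraph V) (m : ℕ) : Submodule R (Chain R V m) :=
  Submodule.span R ((fun v : Fin m → V => Finsupp.single v (1 : R)) '' {v | IsAllowedPath G v})

/-- The space `Ω_p = {v ∈ 𝒜_p | ∂ v ∈ 𝒜_{p-1}}` of `∂`-invariant `p`-paths. -/
def invariantChains (F : PathFlavour) (G : Digraph V) (p : ℕ) :
    Submodule R (Chain R V (p + 1)) :=
  allowedChains R G (p + 1) ⊓ (allowedChains R G p).comap (boundary R V F p)

/-- The `k`-cycles: the kernel of `∂ₖ` restricted to `Ωₖ`. -/
def cycles (F : PathFlavour) (G : Digraph V) (k : ℕ) : Submodule R (Chain R V (k + 1)) :=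
  invariantChains R F G k ⊓ LinearMap.ker (boundary R V F k)

/-- The `k`-boundaries: the image of `Ωₖ₊₁` under `∂ₖ₊₁`. -/
def boundaries (F : PathFlavour) (G : Digraph V) (k : ℕ) : Submodule R (Chain R V (k + 1)) :=
  (invariantChains R F G (k + 1)).map (boundary R V F (k + 1))

/-- The rank of the quotient module `Z / B`, for a submodule `B` of a submodule `Z` of `M`. It is
applied below to the boundaries `B` and the cycles `Z`, where `B ≤ Z` because `∂ ∘ ∂ = 0`. -/
def quotientRank {M : Type*} [AddCommGroup M] [Module R M] (Z B : Submodule R M) : ℕ :=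
  Module.finrank R (Z ⧸ B.submoduleOf Z)

/-- The `k`-th Betti number of `G` with coefficients in `R`: the rank of the `k`-th (reduced) path
homology `ker ∂ₖ / im ∂ₖ₊₁`. -/
def betti (F : PathFlavour) (G : Digraph V) (k : ℕ) : ℕ :=
  quotientRank R (cycles R F G k) (boundaries R F G k)

end PathHomology

namespace RandomDigraph

/-- The possible edges of a simple digraph on `n` labelled nodes: the `n (n - 1)` ordered pairs of
distinct nodes. -/
def possibleEdges (n : ℕ) : Finset (Fin n × Fin n) :=
  Finset.univ.offDiag

/-- The digraph with a given edge set. -/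
def ofEdges {n : ℕ} (E : Finset (Fin n × Fin n)) : Digraph (Fin n) where
  Adj i j := (i, j) ∈ E

/-- The probability `p ^ m (1 - p) ^ (n (n - 1) - m)` of a given simple digraph with `n` nodes and
`m` edges in the directed Erdős–Rényi model, where each possible edge is present independently with
probability `p`. -/
def weight (n : ℕ) (p : ℝ) (E : Finset (Fin n × Fin n)) : ℝ :=
  p ^ E.card * (1 - p) ^ (n * (n - 1) - E.card)

/-- The expectation of `X G` for `G` drawn from the directed Erdős–Rényi model on `n` nodes with
edge probability `p`. -/
def expectation (n : ℕ) (p : ℝ) (X : Digraph (Fin n) → ℝ) : ℝ :=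
  ∑ E ∈ (possibleEdges n).powerset, weight n p E * X (ofEdges E)

open Classical in
/-- The probability that `G` has the property `P`, for `G` drawn from the directed Erdős–Rényi model
on `n` nodes with edge probability `p`. -/
def probability (n : ℕ) (p : ℝ) (P : Digraph (Fin n) → Prop) : ℝ :=
  ∑ E ∈ (possibleEdges n).powerset with P (ofEdges E), weight n p E

/-- A graph property holds with high probability along the models with edge probabilities `p n`. -/
def HoldsWHP (p : ℕ → ℝ) (P : ∀ n : ℕ, Digraph (Fin n) → Prop) : Prop :=
  Tendsto (fun n : ℕ => probability n (p n) (P n)) atTop (𝓝 1)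

end RandomDigraph

end

/-! Write `Z` for the 1-cycles. Since `Ω₁` is spanned by the edges and `∂₁` has rank at most `n`,
`|E| - n ≤ rank Z ≤ |E|`. The boundaries have rank at most `rank Ω₂`, hence `|E| - n - rank Ω₂ ≤ β₁
≤ |E|` (`card_sub_betti_le`, `betti_le_card`). `rank Ω₂` is at most the number of two-cycles,
triangles and squares, whose mean is at most `n²p² + n³p³ + n⁴p⁴`. Against the mean edge number, of
order `n²p`, the error `n` is negligible when `p ≫ 1/n`, and `n⁴p⁴` when `p ≪ n^(-2/3)`. This gives
the mean of `β₁`; adding the variance of `|E|` gives positivity.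

For `p ≪ 1/n` there are no nonzero cycles: the support of one has minimum degree two, so some `k`
vertices carry `k` edges (`exists_edges_of_mem_cycles`), and the expected number of such
configurations is at most `∑ (e²np)^k`.

For large `p`, a union bound shows that any three vertices have a common in-neighbour, and then
every cycle is a boundary by a cone argument (`cycles_le_boundaries`).

The two flavours share `∂₁`, and without loops the regular projection fixes allowed chains, so one
argument serves both. -/

noncomputable section

/-! ### Moments of the random edge set. -/

namespace RandomDigraph

lemma card_possibleEdges (n : ℕ) : (possibleEdges n).card = n * (n - 1) := by
  simp [possibleEdges, Finset.offDiag_card, Nat.mul_sub]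

lemma mem_possibleEdges {n : ℕ} {e : Fin n × Fin n} : e ∈ possibleEdges n ↔ e.1 ≠ e.2 := by
  simp [possibleEdges]

/-- The expectation of a function of the random edge set. -/
def edgeExpectation (n : ℕ) (p : ℝ) (X : Finset (Fin n × Fin n) → ℝ) : ℝ :=
  ∑ E ∈ (possibleEdges n).powerset, weight n p E * X E

lemma weight_nonneg {n : ℕ} {p : ℝ} (hp : p ∈ Set.Icc (0 : ℝ) 1) (E : Finset (Fin n × Fin n)) :
    0 ≤ weight n p E :=
  mul_nonneg (pow_nonneg hp.1 _) (pow_nonneg (sub_nonneg.2 hp.2) _)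

lemma edgeExpectation_mono {n : ℕ} {p : ℝ} (hp : p ∈ Set.Icc (0 : ℝ) 1)
    {X Y : Finset (Fin n × Fin n) → ℝ} (h : ∀ E ⊆ possibleEdges n, X E ≤ Y E) :
    edgeExpectation n p X ≤ edgeExpectation n p Y :=
  Finset.sum_le_sum fun E hE =>
    mul_le_mul_of_nonneg_left (h E (Finset.mem_powerset.1 hE)) (weight_nonneg hp E)

lemma edgeExpectation_add (n : ℕ) (p : ℝ) (X Y : Finset (Fin n × Fin n) → ℝ) :
    edgeExpectation n p (fun E => X E + Y E) = edgeExpectation n p X + edgeExpectation n p Y := by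
  simp [edgeExpectation, mul_add, Finset.sum_add_distrib]

lemma edgeExpectation_sub (n : ℕ) (p : ℝ) (X Y : Finset (Fin n × Fin n) → ℝ) :
    edgeExpectation n p (fun E => X E - Y E) = edgeExpectation n p X - edgeExpectation n p Y := by
  simp [edgeExpectation, mul_sub, Finset.sum_sub_distrib]

lemma edgeExpectation_const_mul (n : ℕ) (p c : ℝ) (X : Finset (Fin n × Fin n) → ℝ) :
    edgeExpectation n p (fun E => c * X E) = c * edgeExpectation n p X := by
  simp only [edgeExpectation, Finset.mul_sum]
  exact Finset.sum_congr rfl fun _ _ => by ring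

lemma edgeExpectation_sum {ι : Type*} (n : ℕ) (p : ℝ) (s : Finset ι)
    (X : ι → Finset (Fin n × Fin n) → ℝ) :
    edgeExpectation n p (fun E => ∑ i ∈ s, X i E) = ∑ i ∈ s, edgeExpectation n p (X i) := by
  simp only [edgeExpectation, Finset.mul_sum]
  exact Finset.sum_comm

/-- The edge sets containing `S` are `S ∪ T` with `T` disjoint from `S`; after factoring out `p ^
S.card` the weights of the `T` form the binomial expansion of `(p + (1 - p)) ^ N = 1`. -/
lemma edgeExpectation_subset {n : ℕ} (p : ℝ) {S : Finset (Fin n × Fin n)}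
    (hS : S ⊆ possibleEdges n) :
    edgeExpectation n p (fun E => if S ⊆ E then 1 else 0) = p ^ S.card := by
  have hfilter : (possibleEdges n).powerset.filter (fun E => S ⊆ E) =
      (possibleEdges n \ S).powerset.image (S ∪ ·) := by
    rw [← Finset.Icc_eq_image_powerset hS]
    ext E
    simp [and_comm]
  have hdisj : ∀ T ∈ (possibleEdges n \ S).powerset, Disjoint S T := fun T hT =>
    Finset.disjoint_of_subset_right (Finset.mem_powerset.1 hT) Finset.disjoint_sdiff
  have hinj : Set.InjOn (S ∪ ·)
      ((possibleEdges n \ S).powerset : Set (Finset (Fin n × Fin n))) := by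
    intro T hT T' hT' h
    have h' : (S ∪ T) \ S = (S ∪ T') \ S := congrArg (· \ S) h
    rwa [Finset.union_sdiff_cancel_left (hdisj T hT),
      Finset.union_sdiff_cancel_left (hdisj T' hT')] at h'
  simp only [edgeExpectation, mul_ite, mul_one, mul_zero]
  rw [← Finset.sum_filter, hfilter, Finset.sum_image hinj]
  have hsum := Finset.sum_pow_mul_eq_add_pow p (1 - p) (possibleEdges n \ S)
  rw [add_sub_cancel, one_pow] at hsum
  rw [← mul_one (p ^ S.card), ← hsum, Finset.mul_sum]
  refine Finset.sum_congr rfl fun T hT => ?_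
  rw [weight, Finset.card_union_of_disjoint (hdisj T hT), Finset.card_sdiff_of_subset hS,
    card_possibleEdges, pow_add, mul_assoc, Nat.sub_sub]

lemma edgeExpectation_const (n : ℕ) (p c : ℝ) : edgeExpectation n p (fun _ => c) = c := by
  have h := edgeExpectation_subset p (Finset.empty_subset (possibleEdges n))
  have h' := edgeExpectation_const_mul n p c
    (fun E => if (∅ : Finset (Fin n × Fin n)) ⊆ E then 1 else 0)
  rw [h] at h'
  simpa using h'

/-- The size of `S` matters only if `S` has no loops, since otherwise the indicator vanishes. Sums
over all vertex tuples can thus include degenerate ones. -/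
lemma edgeExpectation_subset_le_pow {n : ℕ} {p : ℝ} (hp : 0 ≤ p) {S : Finset (Fin n × Fin n)}
    {k : ℕ} (hS : S ⊆ possibleEdges n → S.card = k) :
    edgeExpectation n p (fun E => if S ⊆ E then 1 else 0) ≤ p ^ k := by
  by_cases h : S ⊆ possibleEdges n
  · rw [← hS h]
    exact (edgeExpectation_subset p h).le
  · refine le_of_eq_of_le (Finset.sum_eq_zero fun E hE => ?_) (pow_nonneg hp _)
    have hSE : ¬ S ⊆ E := fun h' => h (h'.trans (Finset.mem_powerset.1 hE))
    simp [hSE]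

lemma expectation_eq_edgeExpectation (n : ℕ) (p : ℝ) (X : Digraph (Fin n) → ℝ) :
    expectation n p X = edgeExpectation n p (fun E => X (ofEdges E)) := rfl

open Classical in
lemma probability_eq_edgeExpectation (n : ℕ) (p : ℝ) (P : Digraph (Fin n) → Prop) :
    probability n p P = edgeExpectation n p (fun E => if P (ofEdges E) then 1 else 0) := by
  simp [probability, edgeExpectation, Finset.sum_filter]

open Classical in
/-- A property holds with high probability if the probability of its failure is dominated by
the expectations of functions that tend to `0`. -/
lemma holdsWHP_of_edgeExpectation_le {p : ℕ → ℝ} (hp : ∀ n, p n ∈ Set.Icc (0 : ℝ) 1)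
    {P : ∀ n : ℕ, Digraph (Fin n) → Prop} {X : ∀ n, Finset (Fin n × Fin n) → ℝ} {δ : ℕ → ℝ}
    (hδ : Tendsto δ atTop (𝓝 0))
    (hX : ∀ᶠ n in atTop, (∀ E ⊆ possibleEdges n, 0 ≤ X n E ∧ (¬ P n (ofEdges E) → 1 ≤ X n E)) ∧
      edgeExpectation n (p n) (X n) ≤ δ n) :
    HoldsWHP p P := by
  have hlower : Tendsto (fun n => 1 - δ n) atTop (𝓝 1) := by simpa using hδ.const_sub 1
  refine tendsto_of_tendsto_of_tendsto_of_le_of_le' hlower tendsto_const_nhds ?_ ?_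
  · filter_upwards [hX] with n hn
    rw [probability_eq_edgeExpectation]
    calc 1 - δ n ≤ edgeExpectation n (p n) (fun _ => 1) - edgeExpectation n (p n) (X n) := by
          rw [edgeExpectation_const]; linarith [hn.2]
      _ = edgeExpectation n (p n) (fun E => 1 - X n E) := (edgeExpectation_sub _ _ _ _).symm
      _ ≤ _ := by
          refine edgeExpectation_mono (hp n) fun E hE => ?_
          obtain ⟨h0, h1⟩ := hn.1 E hE
          split_ifs with h
          · linarith
          · linarith [h1 h]
  · refine Eventually.of_forall fun n => ?_
    rw [probability_eq_edgeExpectation]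
    refine (edgeExpectation_mono (hp n) (Y := fun _ => 1) fun E hE => ?_).trans_eq
      (edgeExpectation_const _ _ _)
    split_ifs <;> norm_num

/-- Independence: the probability that none of a family of disjoint edge sets is present. -/
lemma edgeExpectation_prod_one_sub {n : ℕ} (p : ℝ) {ι : Type*} [DecidableEq ι] (W : Finset ι)
    (S : ι → Finset (Fin n × Fin n)) (hS : ∀ w ∈ W, S w ⊆ possibleEdges n)
    (hdisj : (W : Set ι).PairwiseDisjoint S) :
    edgeExpectation n p (fun E => ∏ w ∈ W, (1 - if S w ⊆ E then 1 else 0)) =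
      ∏ w ∈ W, (1 - p ^ (S w).card) := by
  -- Both products are expanded over subsets `J` of `W`; disjointness makes the sizes add up in each
  -- term.
  simp only [sub_eq_add_neg, Finset.prod_one_add, edgeExpectation_sum]
  refine Finset.sum_congr rfl fun J hJ => ?_
  have hJW := Finset.mem_powerset.1 hJ
  have hunion : J.biUnion S ⊆ possibleEdges n :=
    Finset.biUnion_subset.2 fun w hw => hS w (hJW hw)
  have hcard : (J.biUnion S).card = ∑ w ∈ J, (S w).card :=
    Finset.card_biUnion fun a ha b hb hab => hdisj (hJW ha) (hJW hb) hab
  have h := edgeExpectation_subset p hunion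
  rw [hcard, ← Finset.prod_pow_eq_pow_sum] at h
  simp only [Finset.prod_neg]
  rw [← h, edgeExpectation_const_mul]
  congr 2
  funext E
  rw [Finset.prod_ite_zero]
  simp

lemma edgeExpectation_card (n : ℕ) (p : ℝ) :
    edgeExpectation n p (fun E => (E.card : ℝ)) = n * (n - 1) * p := by
  have h : edgeExpectation n p (fun E => (E.card : ℝ)) =
      edgeExpectation n p (fun E => ∑ e ∈ possibleEdges n, if {e} ⊆ E then 1 else 0) := by
    refine Finset.sum_congr rfl fun E hE => ?_
    congr 1
    simp [Finset.inter_eq_right.2 (Finset.mem_powerset.1 hE)]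
  rw [h, edgeExpectation_sum, Finset.sum_congr rfl fun e he =>
    edgeExpectation_subset p (Finset.singleton_subset_iff.2 he)]
  simp only [Finset.card_singleton, pow_one, Finset.sum_const, card_possibleEdges, nsmul_eq_mul]
  rcases n with _ | n <;> simp

/-- The variance of the number of edges is at most its mean. -/
lemma edgeExpectation_card_sub_sq_le (n : ℕ) {p : ℝ} (hp : p ∈ Set.Icc (0 : ℝ) 1) :
    edgeExpectation n p (fun E => ((E.card : ℝ) - n * (n - 1) * p) ^ 2) ≤ n * (n - 1) * p := by
  set μ : ℝ := n * (n - 1) * p with hμ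
  have hN : ((possibleEdges n).card : ℝ) = n * (n - 1) := by
    rw [card_possibleEdges]
    rcases n with _ | n <;> simp
  have hsq : edgeExpectation n p (fun E => (E.card : ℝ) ^ 2) ≤ μ ^ 2 + μ := by
    have h : edgeExpectation n p (fun E => (E.card : ℝ) ^ 2) =
        edgeExpectation n p (fun E => ∑ e ∈ possibleEdges n, ∑ f ∈ possibleEdges n,
          if {e, f} ⊆ E then 1 else 0) := by
      refine Finset.sum_congr rfl fun E hE => ?_
      congr 1
      have hE' := Finset.inter_eq_right.2 (Finset.mem_powerset.1 hE)
      have hc : (E.card : ℝ) = ∑ e ∈ possibleEdges n, if e ∈ E then 1 else 0 := by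
        simp [hE']
      simp only [sq, hc, Finset.sum_mul_sum]
      refine Finset.sum_congr rfl fun e _ => Finset.sum_congr rfl fun f _ => ?_
      by_cases he : e ∈ E <;> by_cases hf : f ∈ E <;> simp [Finset.insert_subset_iff, he, hf]
    rw [h, edgeExpectation_sum]
    have hterm : ∀ e ∈ possibleEdges n, edgeExpectation n p (fun E => ∑ f ∈ possibleEdges n,
        if {e, f} ⊆ E then (1 : ℝ) else 0) ≤ (possibleEdges n).card * p ^ 2 + p := by
      intro e he
      rw [edgeExpectation_sum]
      -- Distinct edges are uncorrelated, so only the diagonal `e = f` adds to the squared mean.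
      have hf : ∀ f ∈ possibleEdges n, edgeExpectation n p (fun E =>
          if {e, f} ⊆ E then (1 : ℝ) else 0) ≤ p ^ 2 + if e = f then p else 0 := by
        intro f _
        refine (edgeExpectation_subset_le_pow hp.1 fun _ => rfl).trans ?_
        by_cases hef : e = f
        · subst hef
          simp [sq_nonneg]
        · simp [Finset.card_pair hef, hef]
      refine (Finset.sum_le_sum hf).trans_eq ?_
      simp [Finset.sum_add_distrib, he]
    refine (Finset.sum_le_sum hterm).trans_eq ?_
    simp only [Finset.sum_const, nsmul_eq_mul, hN, hμ]
    ring
  have hexp : edgeExpectation n p (fun E => ((E.card : ℝ) - μ) ^ 2) =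
      edgeExpectation n p (fun E => (E.card : ℝ) ^ 2) -
        2 * μ * edgeExpectation n p (fun E => (E.card : ℝ)) + μ ^ 2 := by
    rw [← edgeExpectation_const_mul, ← edgeExpectation_sub]
    conv_rhs => rw [← edgeExpectation_const n p (μ ^ 2)]
    rw [← edgeExpectation_add]
    congr 1
    funext E
    ring
  rw [hexp, edgeExpectation_card]
  nlinarith

end RandomDigraph

/-! ### Chains and boundaries in low degree. -/

namespace PathHomology

variable (R : Type*) [CommRing R] {V : Type*}

lemma allowedChains_eq_supported (G : Digraph V) (m : ℕ) :
    allowedChains R G m = Finsupp.supported R R {v : Fin m → V | IsAllowedPath G v} :=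
  (Finsupp.supported_eq_span_single R _).symm

lemma isAllowedPath_one (G : Digraph V) (v : Fin 1 → V) : IsAllowedPath G v := by
  intro i j h
  omega

lemma isRegularPath_one (v : Fin 1 → V) : IsRegularPath v := by
  intro i j h
  omega

lemma isAllowedPath_two {G : Digraph V} {v : Fin 2 → V} :
    IsAllowedPath G v ↔ G.Adj (v 0) (v 1) := by
  simp [IsAllowedPath, Fin.forall_fin_two]

lemma isAllowedPath_three {G : Digraph V} {v : Fin 3 → V} :
    IsAllowedPath G v ↔ G.Adj (v 0) (v 1) ∧ G.Adj (v 1) (v 2) := by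
  simp [IsAllowedPath, Fin.forall_fin_succ]

lemma single_mem_allowedChains {G : Digraph V} {m : ℕ} {v : Fin m → V} (hv : IsAllowedPath G v)
    (r : R) : Finsupp.single v r ∈ allowedChains R G m := by
  rw [allowedChains_eq_supported]
  exact Finsupp.single_mem_supported R r hv

lemma allowedChains_one (G : Digraph V) : allowedChains R G 1 = ⊤ := by
  have h : {v : Fin 1 → V | IsAllowedPath G v} = Set.univ :=
    Set.eq_univ_of_forall (isAllowedPath_one G)
  rw [allowedChains_eq_supported, h, Finsupp.supported_univ]

lemma invariantChains_one (F : PathFlavour) (G : Digraph V) :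
    invariantChains R F G 1 = allowedChains R G 2 := by
  simp [invariantChains, allowedChains_one]

lemma regularProjection_single_of_isRegularPath {m : ℕ} {v : Fin m → V} (hv : IsRegularPath v)
    (r : R) : regularProjection R V m (Finsupp.single v r) = Finsupp.single v r := by
  simp [regularProjection, hv]

/-- A sequence with one vertex is vacuously regular, so the projection is the identity there. -/
lemma boundary_one (F : PathFlavour) : boundary R V F 1 = nonregularBoundary R V 1 := by
  cases F with
  | nonregular => rfl
  | regular =>
    have h : regularProjection R V 1 = LinearMap.id := by
      ext v : 1
      ext
      simp [regularProjection_single_of_isRegularPath R (isRegularPath_one v)]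
    simp [boundary, h]

lemma isRegularPath_of_isAllowedPath {G : Digraph V} (hG : ∀ a, ¬ G.Adj a a) {m : ℕ}
    {v : Fin m → V} (hv : IsAllowedPath G v) : IsRegularPath v := by
  intro i j hij h
  exact hG (v j) (h ▸ hv i j hij)

lemma regularProjection_of_mem_allowedChains {G : Digraph V} (hG : ∀ a, ¬ G.Adj a a) {m : ℕ}
    {x : Chain R V m} (hx : x ∈ allowedChains R G m) : regularProjection R V m x = x := by
  refine Submodule.span_induction (p := fun x _ => regularProjection R V m x = x) ?_ ?_ ?_ ?_ hx
  · rintro _ ⟨v, hv, rfl⟩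
    exact regularProjection_single_of_isRegularPath R (isRegularPath_of_isAllowedPath hG hv) 1
  · simp
  · intro x y _ _ hx hy
    rw [map_add, hx, hy]
  · intro r x _ hx
    rw [map_smul, hx]

lemma regularProjection_apply_of_isRegularPath {m : ℕ} {v : Fin m → V} (hv : IsRegularPath v)
    (x : Chain R V m) : regularProjection R V m x v = x v := by
  classical
  induction x using Finsupp.induction_linear with
  | zero => simp
  | add x y hx hy => simp [hx, hy]
  | single u r =>
    by_cases hu : IsRegularPath u
    · rw [regularProjection_single_of_isRegularPath R hu]
    · have huv : u ≠ v := fun h => hu (h ▸ hv)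
      simp [regularProjection, hu, huv]

lemma nonregularBoundary_single_one (a b : V) (r : R) :
    nonregularBoundary R V 1 (Finsupp.single ![a, b] r) =
      Finsupp.single ![b] r - Finsupp.single ![a] r := by
  have h0 : (fun j : Fin 1 => (![a, b] : Fin 2 → V) ((0 : Fin 2).succAbove j)) = ![b] := by
    ext j; fin_cases j; rfl
  have h1 : (fun j : Fin 1 => (![a, b] : Fin 2 → V) ((1 : Fin 2).succAbove j)) = ![a] := by
    ext j; fin_cases j; rfl
  rw [nonregularBoundary, Finsupp.linearCombination_single, Fin.sum_univ_two, h0, h1]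
  simp [sub_eq_add_neg]

lemma nonregularBoundary_single_two (a b c : V) (r : R) :
    nonregularBoundary R V 2 (Finsupp.single ![a, b, c] r) =
      Finsupp.single ![b, c] r - Finsupp.single ![a, c] r + Finsupp.single ![a, b] r := by
  have h0 : (fun j : Fin 2 => (![a, b, c] : Fin 3 → V) ((0 : Fin 3).succAbove j)) = ![b, c] := by
    ext j; fin_cases j <;> rfl
  have h1 : (fun j : Fin 2 => (![a, b, c] : Fin 3 → V) ((1 : Fin 3).succAbove j)) = ![a, c] := by
    ext j; fin_cases j <;> rfl
  have h2 : (fun j : Fin 2 => (![a, b, c] : Fin 3 → V) ((2 : Fin 3).succAbove j)) = ![a, b] := by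
    ext j; fin_cases j <;> rfl
  rw [nonregularBoundary, Finsupp.linearCombination_single, Fin.sum_univ_three, h0, h1, h2]
  simp [sub_eq_add_neg]

/-- Produces boundaries for both flavours at once: an allowed chain is fixed by the projection when
there are no loops. -/
lemma nonregularBoundary_mem_boundaries (F : PathFlavour) {G : Digraph V}
    (hG : ∀ a, ¬ G.Adj a a) {x : Chain R V 3} (hx : x ∈ allowedChains R G 3)
    (hdx : nonregularBoundary R V 2 x ∈ allowedChains R G 2) :
    nonregularBoundary R V 2 x ∈ boundaries R F G 1 := by
  have hb : boundary R V F 2 x = nonregularBoundary R V 2 x := by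
    cases F with
    | nonregular => rfl
    | regular => exact regularProjection_of_mem_allowedChains R hG hdx
  refine ⟨x, ⟨hx, ?_⟩, hb⟩
  rwa [← hb] at hdx

/-! ### The cone argument. -/

section Cone

variable {R} {F : PathFlavour} {G : Digraph V}

lemma triangle_mem_boundaries (hG : ∀ a, ¬ G.Adj a a) {a b c : V} (hab : G.Adj a b)
    (hbc : G.Adj b c) (hac : G.Adj a c) :
    (Finsupp.single ![b, c] 1 - Finsupp.single ![a, c] 1 + Finsupp.single ![a, b] 1 :
      Chain R V 2) ∈ boundaries R F G 1 := by
  rw [← nonregularBoundary_single_two]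
  refine nonregularBoundary_mem_boundaries R F hG
    (single_mem_allowedChains R (isAllowedPath_three.2 ⟨hab, hbc⟩) 1) ?_
  rw [nonregularBoundary_single_two]
  exact add_mem (sub_mem (single_mem_allowedChains R (isAllowedPath_two.2 hbc) 1)
    (single_mem_allowedChains R (isAllowedPath_two.2 hac) 1))
    (single_mem_allowedChains R (isAllowedPath_two.2 hab) 1)

/-- The middle faces `a c` of the two paths cancel, so `a c` need not be an edge. -/
lemma square_mem_boundaries (hG : ∀ a, ¬ G.Adj a a) {a b b' c : V} (hab : G.Adj a b)
    (hbc : G.Adj b c) (hab' : G.Adj a b') (hbc' : G.Adj b' c) :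
    ((Finsupp.single ![a, b] 1 + Finsupp.single ![b, c] 1) -
      (Finsupp.single ![a, b'] 1 + Finsupp.single ![b', c] 1) : Chain R V 2) ∈
      boundaries R F G 1 := by
  have h : nonregularBoundary R V 2
      (Finsupp.single ![a, b, c] 1 - Finsupp.single ![a, b', c] 1) =
      ((Finsupp.single ![a, b] 1 + Finsupp.single ![b, c] 1) -
      (Finsupp.single ![a, b'] 1 + Finsupp.single ![b', c] 1) : Chain R V 2) := by
    rw [map_sub, nonregularBoundary_single_two, nonregularBoundary_single_two]
    abel
  rw [← h]
  refine nonregularBoundary_mem_boundaries R F hG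
    (sub_mem (single_mem_allowedChains R (isAllowedPath_three.2 ⟨hab, hbc⟩) 1)
      (single_mem_allowedChains R (isAllowedPath_three.2 ⟨hab', hbc'⟩) 1)) ?_
  rw [h]
  exact sub_mem (add_mem (single_mem_allowedChains R (isAllowedPath_two.2 hab) 1)
    (single_mem_allowedChains R (isAllowedPath_two.2 hbc) 1))
    (add_mem (single_mem_allowedChains R (isAllowedPath_two.2 hab') 1)
    (single_mem_allowedChains R (isAllowedPath_two.2 hbc') 1))

/-- If any three vertices have a common in-neighbour, then every `1`-cycle is a boundary: modulo
boundaries, an edge from `a` to `b` is the difference of the values at `b` and `a` of the potential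
`x ↦ (w → x) - (w → o)`, where `w` is any common in-neighbour of `x` and a base point `o`. -/
lemma cycles_le_boundaries [Nonempty V] (hG : ∀ a, ¬ G.Adj a a)
    (hcone : ∀ a b c, ∃ w, G.Adj w a ∧ G.Adj w b ∧ G.Adj w c) :
    cycles R F G 1 ≤ boundaries R F G 1 := by
  set q := (boundaries R F G 1).mkQ with hq
  let e : V → V → Chain R V 2 ⧸ boundaries R F G 1 := fun a b => q (Finsupp.single ![a, b] 1)
  have htri : ∀ a b c, G.Adj a b → G.Adj b c → G.Adj a c → e b c - e a c + e a b = 0 := by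
    intro a b c hab hbc hac
    simpa [e, hq, ← Submodule.Quotient.mk_sub, ← Submodule.Quotient.mk_add] using
      triangle_mem_boundaries (R := R) (F := F) hG hab hbc hac
  have hsq : ∀ a b b' c, G.Adj a b → G.Adj b c → G.Adj a b' → G.Adj b' c →
      e a b + e b c = e a b' + e b' c := by
    intro a b b' c hab hbc hab' hbc'
    rw [← sub_eq_zero]
    simpa [e, hq, ← Submodule.Quotient.mk_sub, ← Submodule.Quotient.mk_add] using
      square_mem_boundaries (R := R) (F := F) hG hab hbc hab' hbc'
  have hindep : ∀ w w' a b, G.Adj w a → G.Adj w b → G.Adj w' a → G.Adj w' b →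
      e w b - e w a = e w' b - e w' a := by
    intro w w' a b hwa hwb hwa' hwb'
    -- A common in-neighbour `u` of `w` and `w'` spans squares with tops `a` and `b`; their
    -- relations are subtracted.
    obtain ⟨u, hu, hu', -⟩ := hcone w w' w
    have h1 := hsq u w w' a hu hwa hu' hwa'
    have h2 := hsq u w w' b hu hwb hu' hwb'
    have h3 : e w b - e w a = (e u w + e w b) - (e u w + e w a) := by abel
    rw [h3, h1, h2]
    abel
  let o : V := Classical.arbitrary V
  choose w hwo hwx _ using fun x => hcone o x o
  let ψ : V → Chain R V 2 ⧸ boundaries R F G 1 := fun x => e (w x) x - e (w x) o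
  have hpot : ∀ a b, G.Adj a b → e a b = ψ b - ψ a := by
    intro a b hab
    -- One apex `u` over `a`, `b`, `o` computes both potentials, and the triangle `u a b` compares
    -- them.
    obtain ⟨u, hua, hub, huo⟩ := hcone a b o
    have h1 : ψ a = e u a - e u o := hindep _ _ _ _ (hwo a) (hwx a) huo hua
    have h2 : ψ b = e u b - e u o := hindep _ _ _ _ (hwo b) (hwx b) huo hub
    have h3 := htri u a b hua hab hub
    rw [h1, h2, ← sub_eq_zero, ← h3]
    abel
  -- Extended linearly, the potential shows that the class of an allowed chain factors through its
  -- boundary, hence is zero on cycles.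
  let Ψ : Chain R V 1 →ₗ[R] Chain R V 2 ⧸ boundaries R F G 1 :=
    Finsupp.linearCombination R fun v => ψ (v 0)
  have hΨ : ∀ z ∈ allowedChains R G 2, q z = Ψ (nonregularBoundary R V 1 z) := by
    intro z hz
    refine Submodule.span_induction
      (p := fun z _ => q z = Ψ (nonregularBoundary R V 1 z)) ?_ ?_ ?_ ?_ hz
    · rintro _ ⟨v, hv, rfl⟩
      have hv2 : v = ![v 0, v 1] := by ext i; fin_cases i <;> rfl
      have := hpot _ _ (isAllowedPath_two.1 hv)
      simp only
      rw [hv2, nonregularBoundary_single_one]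
      simpa [Ψ, e] using this
    · simp
    · intro x y _ _ hx hy
      simp only [map_add, hx, hy]
    · intro r x _ hx
      simp only [map_smul, hx]
  rintro z ⟨hz, hdz⟩
  rw [invariantChains_one] at hz
  rw [boundary_one] at hdz
  have := hΨ z hz
  rw [LinearMap.mem_ker.1 hdz, map_zero] at this
  exact (Submodule.Quotient.mk_eq_zero _).1 this

lemma betti_eq_zero_of_cycles_le_boundaries [Nontrivial R]
    (h : cycles R F G 1 ≤ boundaries R F G 1) : betti R F G 1 = 0 := by
  have htop : (boundaries R F G 1).submoduleOf (cycles R F G 1) = ⊤ := by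
    rw [Submodule.submoduleOf, Submodule.comap_subtype_eq_top]
    exact h
  rw [betti, quotientRank, htop]
  exact Module.finrank_zero_of_subsingleton

end Cone

/-! ### Supports of cycles. -/

section MinDegree

variable {R}

lemma nonregularBoundary_one_apply [DecidableEq V] (f : Chain R V 2) (s : V) :
    nonregularBoundary R V 1 f ![s] =
      ∑ v ∈ f.support, f v * ((if v 1 = s then 1 else 0) - if v 0 = s then 1 else 0) := by
  have h : ∀ a b : V, (![a] : Fin 1 → V) = ![b] ↔ a = b := fun a b => by
    simp
  conv_lhs => rw [← Finsupp.sum_single f, Finsupp.sum, map_sum]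
  rw [Finsupp.finsetSum_apply]
  refine Finset.sum_congr rfl fun v _ => ?_
  have hv2 : v = ![v 0, v 1] := by ext i; fin_cases i <;> rfl
  conv_lhs => rw [hv2]
  rw [nonregularBoundary_single_one, ← hv2]
  simp [Finsupp.single_apply, mul_sub]

/-- The support of a nonzero `1`-cycle has minimum degree two, so it contains a set of edges that
spans no more vertices than it has edges. -/
lemma exists_edges_of_mem_cycles [DecidableEq V] {F : PathFlavour} {G : Digraph V}
    (hG : ∀ a, ¬ G.Adj a a) {f : Chain R V 2} (hf : f ∈ cycles R F G 1) (hf0 : f ≠ 0) :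
    ∃ (S : Finset V) (H : Finset (V × V)), S.Nonempty ∧ H ⊆ S ×ˢ S ∧
      (∀ e ∈ H, G.Adj e.1 e.2) ∧ H.card = S.card := by
  obtain ⟨hfA, hdf⟩ := hf
  rw [invariantChains_one, allowedChains_eq_supported] at hfA
  rw [boundary_one] at hdf
  replace hdf := LinearMap.mem_ker.1 hdf
  have hadj : ∀ v ∈ f.support, G.Adj (v 0) (v 1) := fun v hv =>
    isAllowedPath_two.1 ((Finsupp.mem_supported R f).1 hfA hv)
  let S : Finset V := f.support.biUnion fun v => {v 0, v 1}
  let E : Finset (V × V) := f.support.image fun v => (v 0, v 1)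
  have hES : E ⊆ S ×ˢ S := by
    intro e he
    obtain ⟨v, hv, rfl⟩ := Finset.mem_image.1 he
    simp only [Finset.mem_product, S, Finset.mem_biUnion]
    exact ⟨⟨v, hv, by simp⟩, ⟨v, hv, by simp⟩⟩
  have hEcard : E.card = f.support.card := by
    refine Finset.card_image_of_injective _ fun v v' h => ?_
    ext i
    fin_cases i
    · exact congrArg Prod.fst h
    · exact congrArg Prod.snd h
  -- If a single supporting edge met `s`, its coefficient would survive, up to sign, in `∂f` at `s`,
  -- because the edge is not a loop.
  have hdeg : ∀ s ∈ S, 2 ≤ (f.support.bipartiteAbove (fun s v => v 0 = s ∨ v 1 = s) s).card := by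
    intro s hs
    obtain ⟨v, hv, hvs⟩ := Finset.mem_biUnion.1 hs
    have hvs' : v 0 = s ∨ v 1 = s := by
      simpa [eq_comm] using hvs
    by_contra! hlt
    have huniq : ∀ u ∈ f.support, u ≠ v → ¬ (u 0 = s ∨ u 1 = s) := by
      intro u hu huv hus
      refine absurd (Finset.one_lt_card.2 ⟨u, ?_, v, ?_, huv⟩)
        (Nat.not_lt.2 (Nat.le_of_lt_succ hlt))
      · simp only [Finset.mem_bipartiteAbove]; exact ⟨hu, hus⟩
      · simp only [Finset.mem_bipartiteAbove]; exact ⟨hv, hvs'⟩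
    have hsum := nonregularBoundary_one_apply f s
    rw [hdf, Finset.sum_eq_single v] at hsum
    · have hne : v 0 ≠ v 1 := fun h => hG (v 1) (h ▸ hadj v hv)
      have hfv : f v ≠ 0 := Finsupp.mem_support_iff.1 hv
      rcases hvs' with rfl | rfl
      · exact hfv (by simpa [hne.symm] using hsum)
      · exact hfv (by simpa [hne] using hsum.symm)
    · intro u hu huv
      have := huniq u hu huv
      push Not at this
      simp [this.1, this.2]
    · exact fun h => absurd hv h
  -- Double counting of incidences: at least two edges at each vertex, at most two vertices on each
  -- edge.
  have hcard : S.card ≤ E.card := by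
    have h := Finset.card_mul_le_card_mul (s := S) (t := f.support) (m := 2) (n := 2)
      (fun s v => v 0 = s ∨ v 1 = s) hdeg (fun v _ => by
        refine (Finset.card_le_card (t := {v 0, v 1}) fun s hs => ?_).trans Finset.card_le_two
        simp only [Finset.mem_bipartiteBelow] at hs
        simpa [eq_comm] using hs.2)
    omega
  obtain ⟨H, hHE, hH⟩ := Finset.exists_subset_card_eq hcard
  obtain ⟨v, hv⟩ := Finsupp.support_nonempty_iff.2 hf0
  refine ⟨S, H, ⟨v 0, ?_⟩, hHE.trans hES, fun e he => ?_, hH⟩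
  · exact Finset.mem_biUnion.2 ⟨v, hv, by simp⟩
  · obtain ⟨u, hu, rfl⟩ := Finset.mem_image.1 (hHE he)
    exact hadj u hu

end MinDegree

/-- Only `a b c` contributes to the coefficient at `a c`, through its middle face; its outer faces
differ from `a c` as consecutive vertices are distinct. -/
lemma nonregularBoundary_two_apply_eq {V : Type*} (x : Chain ℤ V 3) (a b c : V)
    (h : ∀ v ∈ x.support, v ≠ ![a, b, c] →
      ![v 1, v 2] ≠ ![a, c] ∧ ![v 0, v 2] ≠ ![a, c] ∧ ![v 0, v 1] ≠ ![a, c])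
    (hab : a ≠ b) (hbc : b ≠ c) :
    nonregularBoundary ℤ V 2 x ![a, c] = - x ![a, b, c] := by
  classical
  conv_lhs => rw [← Finsupp.sum_single x, Finsupp.sum, map_sum]
  rw [Finsupp.finsetSum_apply, Finset.sum_eq_single ![a, b, c]]
  · rw [nonregularBoundary_single_two]
    simp [hab.symm, hbc]
  · intro v hv hne
    obtain ⟨h1, h2, h3⟩ := h v hv hne
    have hv3 : v = ![v 0, v 1, v 2] := by ext i; fin_cases i <;> rfl
    conv_lhs => rw [hv3]
    rw [nonregularBoundary_single_two, Finsupp.add_apply, Finsupp.sub_apply,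
      Finsupp.single_eq_of_ne h1.symm, Finsupp.single_eq_of_ne h2.symm,
      Finsupp.single_eq_of_ne h3.symm]
    simp
  · intro hx
    rw [Finsupp.notMem_support_iff.1 hx]
    simp

/-! ### Integral ranks of cycles, boundaries and `Ω₂`. -/

section Rank

variable {V : Type*} [Fintype V]

lemma finrank_allowedChains (G : Digraph V) (m : ℕ) :
    Module.finrank ℤ (allowedChains ℤ G m) = Nat.card {v : Fin m → V // IsAllowedPath G v} := by
  classical
  rw [allowedChains_eq_supported,
    (Finsupp.supportedEquivFinsupp (M := ℤ) (R := ℤ) _).finrank_eq, Module.finrank_finsupp_self,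
    Nat.card_eq_fintype_card]
  rfl

lemma finrank_cycles_le (F : PathFlavour) (G : Digraph V) :
    Module.finrank ℤ (cycles ℤ F G 1) ≤ Module.finrank ℤ (allowedChains ℤ G 2) := by
  rw [← invariantChains_one ℤ F]
  exact Submodule.finrank_mono inf_le_left

lemma betti_le_finrank_cycles (F : PathFlavour) (G : Digraph V) :
    betti ℤ F G 1 ≤ Module.finrank ℤ (cycles ℤ F G 1) := by
  have := Submodule.finrank_quotient_add_finrank
    ((boundaries ℤ F G 1).submoduleOf (cycles ℤ F G 1))
  rw [betti, quotientRank]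
  omega

lemma betti_le_finrank_allowedChains (F : PathFlavour) (G : Digraph V) :
    betti ℤ F G 1 ≤ Module.finrank ℤ (allowedChains ℤ G 2) :=
  (betti_le_finrank_cycles F G).trans (finrank_cycles_le F G)

/-- Rank–nullity for `∂₁` on the edge chains, with target of rank `Fintype.card V`. -/
lemma finrank_allowedChains_le_finrank_cycles_add (F : PathFlavour) (G : Digraph V) :
    Module.finrank ℤ (allowedChains ℤ G 2) ≤
      Module.finrank ℤ (cycles ℤ F G 1) + Fintype.card V := by
  have h := Submodule.finrank_quotient_add_finrank
    (LinearMap.ker ((boundary ℤ V F 1).domRestrict (allowedChains ℤ G 2)))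
  rw [LinearEquiv.finrank_eq (LinearMap.quotKerEquivRange _)] at h
  have hker : Module.finrank ℤ (LinearMap.ker ((boundary ℤ V F 1).domRestrict
      (allowedChains ℤ G 2))) ≤ Module.finrank ℤ (cycles ℤ F G 1) := by
    rw [← Submodule.finrank_map_subtype_eq]
    refine Submodule.finrank_mono ?_
    rintro _ ⟨z, hz, rfl⟩
    refine ⟨?_, hz⟩
    rw [invariantChains_one]
    exact z.2
  have hrange : Module.finrank ℤ (LinearMap.range ((boundary ℤ V F 1).domRestrict
      (allowedChains ℤ G 2))) ≤ Fintype.card V := by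
    classical
    refine (Submodule.finrank_le _).trans_eq ?_
    rw [Module.finrank_finsupp_self]
    simp
  exact h.symm.trans_le (by omega)

lemma finrank_cycles_le_betti_add (F : PathFlavour) (G : Digraph V) :
    Module.finrank ℤ (cycles ℤ F G 1) ≤
      betti ℤ F G 1 + Module.finrank ℤ (invariantChains ℤ F G 2) := by
  have h := Submodule.finrank_quotient_add_finrank
    ((boundaries ℤ F G 1).submoduleOf (cycles ℤ F G 1))
  have h1 : Module.finrank ℤ ((boundaries ℤ F G 1).submoduleOf (cycles ℤ F G 1)) ≤
      Module.finrank ℤ (boundaries ℤ F G 1) := by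
    rw [← Submodule.finrank_map_subtype_eq]
    refine Submodule.finrank_mono ?_
    rintro _ ⟨z, hz, rfl⟩
    exact hz
  have h2 : Module.finrank ℤ (boundaries ℤ F G 1) ≤
      Module.finrank ℤ (invariantChains ℤ F G 2) :=
    Submodule.finrank_map_le _ _
  rw [betti, quotientRank]
  omega

open Classical in
/-- The rank of `Ω₂` is at most the number of allowed paths `a b c` apart from one path for each
pair `a ≠ c` that is not joined by an edge: an element of `Ω₂` is determined by its coefficients
at those. -/
lemma finrank_invariantChains_two_le (F : PathFlavour) {G : Digraph V}
    (hG : ∀ a, ¬ G.Adj a a) (mid : V → V → V) :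
    Module.finrank ℤ (invariantChains ℤ F G 2) ≤
      Fintype.card {v : Fin 3 → V // IsAllowedPath G v ∧
        (v 0 = v 2 ∨ G.Adj (v 0) (v 2) ∨ v 1 ≠ mid (v 0) (v 2))} := by
  set T := {v : Fin 3 → V // IsAllowedPath G v ∧
        (v 0 = v 2 ∨ G.Adj (v 0) (v 2) ∨ v 1 ≠ mid (v 0) (v 2))}
  let coord : invariantChains ℤ F G 2 →ₗ[ℤ] (T → ℤ) :=
    LinearMap.pi fun v => Finsupp.lapply v.1 ∘ₗ (invariantChains ℤ F G 2).subtype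
  have hinj : Function.Injective coord := by
    rw [injective_iff_map_eq_zero]
    rintro ⟨x, hx, hdx⟩ hcoord
    have hzero : ∀ v, IsAllowedPath G v →
        (v 0 = v 2 ∨ G.Adj (v 0) (v 2) ∨ v 1 ≠ mid (v 0) (v 2)) → x v = 0 := fun v h1 h2 =>
      congrFun hcoord ⟨v, h1, h2⟩
    rw [allowedChains_eq_supported] at hx
    replace hx : ∀ v ∈ x.support, IsAllowedPath G v := fun v hv =>
      (Finsupp.mem_supported ℤ x).1 hx hv
    replace hdx : boundary ℤ V F 2 x ∈ allowedChains ℤ G 2 := hdx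
    rw [allowedChains_eq_supported, Finsupp.mem_supported'] at hdx
    -- What remains has at most one path per non-adjacent pair `a ≠ c`, so nothing can cancel its
    -- middle face, which is not allowed.
    have hsupp : ∀ v ∈ x.support, v 0 ≠ v 2 ∧ ¬ G.Adj (v 0) (v 2) ∧ v 1 = mid (v 0) (v 2) := by
      intro v hv
      by_contra h
      exact Finsupp.mem_support_iff.1 hv (hzero v (hx v hv) (by tauto))
    refine Subtype.ext (Finsupp.support_eq_empty.1 (Finset.eq_empty_of_forall_notMem fun v hv => ?_))
    obtain ⟨hac, hnadj, hmid⟩ := hsupp v hv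
    have hv3 : v = ![v 0, v 1, v 2] := by ext i; fin_cases i <;> rfl
    have hadj := isAllowedPath_three.1 (hx v hv)
    have hcoeff : boundary ℤ V F 2 x ![v 0, v 2] = nonregularBoundary ℤ V 2 x ![v 0, v 2] := by
      cases F with
      | nonregular => rfl
      | regular =>
        refine regularProjection_apply_of_isRegularPath ℤ ?_ _
        simpa [IsRegularPath, Fin.forall_fin_two] using hac
    have hval : nonregularBoundary ℤ V 2 x ![v 0, v 2] = - x ![v 0, v 1, v 2] := by
      refine nonregularBoundary_two_apply_eq x _ _ _ (fun u hu huv => ?_)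
        (fun h => hG (v 1) (h ▸ hadj.1)) (fun h => hG (v 2) (h ▸ hadj.2))
      have huadj := isAllowedPath_three.1 (hx u hu)
      -- Outer faces of `u` are edges, unlike the pair in question; an equal middle face forces `u =
      -- v` via `mid`.
      refine ⟨fun h => hnadj ?_, fun h => huv ?_, fun h => hnadj ?_⟩
      · have h0 : u 1 = v 0 := congrFun h 0
        have h1 : u 2 = v 2 := congrFun h 1
        rw [← h0, ← h1]
        exact huadj.2
      · have h0 : u 0 = v 0 := congrFun h 0
        have h1 : u 2 = v 2 := congrFun h 1
        have h2 : u 1 = v 1 := by rw [hmid, (hsupp u hu).2.2, h0, h1]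
        ext i
        fin_cases i
        exacts [h0, h2, h1]
      · have h0 : u 0 = v 0 := congrFun h 0
        have h1 : u 1 = v 2 := congrFun h 1
        rw [← h0, ← h1]
        exact huadj.1
    rw [← hcoeff, hdx ![v 0, v 2] (fun h => hnadj (isAllowedPath_two.1 h)), ← hv3] at hval
    exact Finsupp.mem_support_iff.1 hv (neg_eq_zero.1 hval.symm)
  refine (LinearMap.finrank_le_finrank_of_injective hinj).trans_eq ?_
  rw [Module.finrank_fintype_fun_eq_card]

end Rank

end PathHomology

/-! ### Comparing `β₁` with the number of edges. -/

namespace RandomDigraph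

open PathHomology

variable {n : ℕ}

lemma not_adj_ofEdges_self {E : Finset (Fin n × Fin n)} (hE : E ⊆ possibleEdges n) (a : Fin n) :
    ¬ (ofEdges E).Adj a a := fun h => mem_possibleEdges.1 (hE h) rfl

lemma finrank_allowedChains_ofEdges (E : Finset (Fin n × Fin n)) :
    Module.finrank ℤ (allowedChains ℤ (ofEdges E) 2) = E.card := by
  rw [finrank_allowedChains, Nat.card_congr ((finTwoArrowEquiv (Fin n)).subtypeEquiv
    (q := fun e => e ∈ E) fun v => isAllowedPath_two), Nat.card_eq_fintype_card,
    Fintype.card_coe]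

/-- The number of triangles `a → b → c`, `a → c` and of two-cycles `a → b → a` and of squares
`a → b → c`, `a → b' → c`. -/
def smallCycleCount (E : Finset (Fin n × Fin n)) : ℝ :=
  (∑ t : Fin n × Fin n × Fin n,
    if {(t.1, t.2.1), (t.2.1, t.2.2), (t.1, t.2.2)} ⊆ E then 1 else 0) +
  (∑ t : Fin n × Fin n, if {(t.1, t.2), (t.2, t.1)} ⊆ E then 1 else 0) +
  ∑ t : Fin n × Fin n × Fin n × Fin n, if t.2.1 ≠ t.2.2.1 then
    (if {(t.1, t.2.1), (t.2.1, t.2.2.2), (t.1, t.2.2.1), (t.2.2.1, t.2.2.2)} ⊆ E then 1 else 0)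
    else 0

lemma finrank_invariantChains_two_le_smallCycleCount (F : PathFlavour)
    {E : Finset (Fin n × Fin n)} (hE : E ⊆ possibleEdges n) :
    (Module.finrank ℤ (invariantChains ℤ F (ofEdges E) 2) : ℝ) ≤ smallCycleCount E := by
  classical
  let G := ofEdges E
  -- With `mid a c` a genuine midpoint whenever one exists, any path with another midpoint completes
  -- to a square.
  have hmid : ∃ mid : Fin n → Fin n → Fin n, ∀ a b c, G.Adj a b → G.Adj b c →
      G.Adj a (mid a c) ∧ G.Adj (mid a c) c := by
    have h : ∀ a c, ∃ m, ∀ b, G.Adj a b → G.Adj b c → G.Adj a m ∧ G.Adj m c := by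
      intro a c
      by_cases h : ∃ b, G.Adj a b ∧ G.Adj b c
      · exact ⟨h.choose, fun _ _ _ => h.choose_spec⟩
      · exact ⟨a, fun b hab hbc => absurd ⟨b, hab, hbc⟩ h⟩
    choose mid hmid using h
    exact ⟨mid, fun a b c => hmid a c b⟩
  obtain ⟨mid, hmid⟩ := hmid
  have h := finrank_invariantChains_two_le F (G := G) (not_adj_ofEdges_self hE) mid
  rw [Fintype.card_subtype] at h
  refine (Nat.cast_le.2 h).trans ?_
  let P1 := (Finset.univ : Finset (Fin n × Fin n × Fin n)).filter fun t =>
    {(t.1, t.2.1), (t.2.1, t.2.2), (t.1, t.2.2)} ⊆ E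
  let P2 := (Finset.univ : Finset (Fin n × Fin n)).filter fun t =>
    {(t.1, t.2), (t.2, t.1)} ⊆ E
  let P3 := (Finset.univ : Finset (Fin n × Fin n × Fin n × Fin n)).filter fun t =>
    t.2.1 ≠ t.2.2.1 ∧
      {(t.1, t.2.1), (t.2.1, t.2.2.2), (t.1, t.2.2.1), (t.2.2.1, t.2.2.2)} ⊆ E
  have hcount : smallCycleCount E = ((P1.card + P2.card + P3.card : ℕ) : ℝ) := by
    simp only [smallCycleCount, P1, P2, P3, ← ite_and, Nat.cast_add, Finset.sum_boole]
  rw [hcount, Nat.cast_le]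
  have hcover : (Finset.univ.filter fun v : Fin 3 → Fin n => IsAllowedPath G v ∧
      (v 0 = v 2 ∨ G.Adj (v 0) (v 2) ∨ v 1 ≠ mid (v 0) (v 2))) ⊆
      P1.image (fun t => ![t.1, t.2.1, t.2.2]) ∪ P2.image (fun t => ![t.1, t.2, t.1]) ∪
        P3.image (fun t => ![t.1, t.2.1, t.2.2.2]) := by
    intro v hv
    obtain ⟨hv, hor⟩ := (Finset.mem_filter.1 hv).2
    obtain ⟨h01, h12⟩ := isAllowedPath_three.1 hv
    have hv3 : ![v 0, v 1, v 2] = v := by ext i; fin_cases i <;> rfl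
    simp only [Finset.mem_union, Finset.mem_image]
    rcases hor with h02 | h02 | hne
    · refine Or.inl (Or.inr ⟨(v 0, v 1), ?_, ?_⟩)
      · simp only [P2, Finset.mem_filter_univ, Finset.insert_subset_iff,
          Finset.singleton_subset_iff]
        exact ⟨h01, h02 ▸ h12⟩
      · conv_rhs => rw [← hv3, ← h02]
    · refine Or.inl (Or.inl ⟨(v 0, v 1, v 2), ?_, hv3⟩)
      simp only [P1, Finset.mem_filter_univ, Finset.insert_subset_iff,
        Finset.singleton_subset_iff]
      exact ⟨h01, h12, h02⟩
    · refine Or.inr ⟨(v 0, v 1, mid (v 0) (v 2), v 2), ?_, hv3⟩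
      simp only [P3, Finset.mem_filter_univ, Finset.insert_subset_iff,
        Finset.singleton_subset_iff]
      exact ⟨hne, h01, h12, hmid _ _ _ h01 h12⟩
  refine (Finset.card_le_card hcover).trans ((Finset.card_union_le _ _).trans ?_)
  exact add_le_add ((Finset.card_union_le _ _).trans (add_le_add Finset.card_image_le
    Finset.card_image_le)) Finset.card_image_le

lemma betti_le_card (F : PathFlavour) (E : Finset (Fin n × Fin n)) :
    betti ℤ F (ofEdges E) 1 ≤ E.card :=
  (betti_le_finrank_allowedChains F _).trans_eq (finrank_allowedChains_ofEdges E)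

lemma card_sub_betti_le (F : PathFlavour) {E : Finset (Fin n × Fin n)}
    (hE : E ⊆ possibleEdges n) :
    (E.card : ℝ) - betti ℤ F (ofEdges E) 1 ≤ n + smallCycleCount E := by
  have h1 := finrank_allowedChains_le_finrank_cycles_add F (ofEdges E)
  have h2 := finrank_cycles_le_betti_add F (ofEdges E)
  rw [finrank_allowedChains_ofEdges, Fintype.card_fin] at h1
  have h3 : (E.card : ℝ) ≤
      betti ℤ F (ofEdges E) 1 + Module.finrank ℤ (invariantChains ℤ F (ofEdges E) 2) + n := by
    exact_mod_cast h1.trans (Nat.add_le_add_right h2 n)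
  linarith [finrank_invariantChains_two_le_smallCycleCount F hE]

lemma edgeExpectation_smallCycleCount_le {p : ℝ} (hp : 0 ≤ p) :
    edgeExpectation n p smallCycleCount ≤ n ^ 3 * p ^ 3 + n ^ 2 * p ^ 2 + n ^ 4 * p ^ 4 := by
  unfold smallCycleCount
  rw [edgeExpectation_add, edgeExpectation_add, edgeExpectation_sum, edgeExpectation_sum,
    edgeExpectation_sum]
  refine add_le_add (add_le_add ?_ ?_) ?_
  · refine (Finset.sum_le_card_nsmul _ _ (p ^ 3) fun t _ => ?_).trans_eq ?_
    · obtain ⟨a, b, c⟩ := t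
      dsimp only
      refine edgeExpectation_subset_le_pow hp fun h => ?_
      simp only [Finset.insert_subset_iff, Finset.singleton_subset_iff, mem_possibleEdges] at h
      obtain ⟨h1, h2, h3⟩ := h
      rw [Finset.card_eq_three]
      exact ⟨_, _, _, by simp [h1], by simp [h2], by simp [h1.symm], rfl⟩
    · simp only [Finset.card_univ, Fintype.card_prod, Fintype.card_fin, nsmul_eq_mul]
      push_cast
      ring
  · refine (Finset.sum_le_card_nsmul _ _ (p ^ 2) fun t _ => ?_).trans_eq ?_
    · obtain ⟨a, b⟩ := t
      dsimp only
      refine edgeExpectation_subset_le_pow hp fun h => ?_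
      simp only [Finset.insert_subset_iff, Finset.singleton_subset_iff, mem_possibleEdges] at h
      exact Finset.card_pair (by simp [h.1])
    · simp only [Finset.card_univ, Fintype.card_prod, Fintype.card_fin, nsmul_eq_mul]
      push_cast
      ring
  · refine (Finset.sum_le_card_nsmul _ _ (p ^ 4) fun t _ => ?_).trans_eq ?_
    · obtain ⟨a, b, b', c⟩ := t
      dsimp only
      split_ifs with hne
      -- The four edges are distinct even when `a = c`: no loops and `b ≠ b'` suffice.
      · refine edgeExpectation_subset_le_pow hp fun h => ?_
        simp only [Finset.insert_subset_iff, Finset.singleton_subset_iff, mem_possibleEdges] at h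
        obtain ⟨h1, h2, h3, h4⟩ := h
        rw [Finset.card_insert_of_notMem (by simp [h1, h3, hne]), Finset.card_eq_three.2
          ⟨_, _, _, by simp [h1.symm], by simp [hne], by simp [h3], rfl⟩]
      · rw [edgeExpectation_const]
        positivity
    · simp only [Finset.card_univ, Fintype.card_prod, Fintype.card_fin, nsmul_eq_mul]
      push_cast
      ring

/-! ### The sparse regime. -/

lemma choose_mul_choose_mul_pow_le {p : ℝ} (hp : 0 ≤ p) (n k : ℕ) :
    (n.choose k : ℝ) * ((k * k).choose k * p ^ k) ≤ (Real.exp 2 * (n * p)) ^ k := by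
  have h1 : (n.choose k : ℝ) ≤ (n : ℝ) ^ k / (k.factorial : ℝ) := Nat.choose_le_pow_div k n
  have h2 : ((k * k).choose k : ℝ) ≤ ((k * k : ℕ) : ℝ) ^ k / (k.factorial : ℝ) :=
    Nat.choose_le_pow_div k (k * k)
  -- Each binomial contributes `1 / k!`; together these absorb `(k * k) ^ k` at the cost of `exp (2
  -- * k)`.
  have h3 : (k : ℝ) ^ k / (k.factorial : ℝ) ≤ Real.exp k :=
    Real.pow_div_factorial_le_exp _ (Nat.cast_nonneg k) k
  calc (n.choose k : ℝ) * ((k * k).choose k * p ^ k)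
      ≤ ((n : ℝ) ^ k / (k.factorial : ℝ)) *
          ((((k * k : ℕ) : ℝ) ^ k / (k.factorial : ℝ)) * p ^ k) := by gcongr
    _ = (n * p) ^ k * ((k : ℝ) ^ k / (k.factorial : ℝ)) ^ 2 := by
        push_cast
        rw [mul_pow, mul_pow]
        ring
    _ ≤ (n * p) ^ k * (Real.exp k) ^ 2 := by gcongr
    _ = _ := by
        rw [mul_pow (Real.exp 2), ← Real.exp_nat_mul, ← Real.exp_nat_mul, mul_comm]
        congr 2
        push_cast
        ring

/-- The number of pairs of a set `S` of `k > 0` vertices and a set of `k` edges within `S`. -/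
def denseSubgraphCount {n : ℕ} (E : Finset (Fin n × Fin n)) : ℝ :=
  ∑ k ∈ Finset.range n, ∑ S ∈ (Finset.univ : Finset (Fin n)).powersetCard (k + 1),
    ∑ H ∈ (S ×ˢ S).powersetCard (k + 1), if H ⊆ E then 1 else 0

lemma denseSubgraphCount_nonneg {n : ℕ} (E : Finset (Fin n × Fin n)) :
    0 ≤ denseSubgraphCount E :=
  Finset.sum_nonneg fun _ _ => Finset.sum_nonneg fun _ _ => Finset.sum_nonneg fun _ _ => by
    split_ifs <;> norm_num

lemma one_le_denseSubgraphCount {n : ℕ} {E S : Finset _} {H : Finset (Fin n × Fin n)}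
    (hS : S.Nonempty) (hHS : H ⊆ S ×ˢ S) (hHE : H ⊆ E) (hcard : H.card = S.card) :
    1 ≤ denseSubgraphCount E := by
  obtain ⟨k, hk⟩ := Nat.exists_eq_succ_of_ne_zero hS.card_pos.ne'
  have hkn : k ∈ Finset.range n := by
    have := S.card_le_univ
    rw [Fintype.card_fin] at this
    rw [Finset.mem_range]
    omega
  have hterm : ∀ (S : Finset (Fin n)) (H : Finset (Fin n × Fin n)),
      (0 : ℝ) ≤ if H ⊆ E then 1 else 0 := fun S H => by split_ifs <;> norm_num
  calc (1 : ℝ) = if H ⊆ E then 1 else 0 := by rw [if_pos hHE]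
    _ ≤ ∑ H ∈ (S ×ˢ S).powersetCard (k + 1), if H ⊆ E then (1 : ℝ) else 0 :=
        Finset.single_le_sum (f := fun H => if H ⊆ E then (1 : ℝ) else 0)
          (fun H _ => hterm S H) (Finset.mem_powersetCard.2 ⟨hHS, hcard.trans hk⟩)
    _ ≤ ∑ S ∈ (Finset.univ : Finset (Fin n)).powersetCard (k + 1),
        ∑ H ∈ (S ×ˢ S).powersetCard (k + 1), if H ⊆ E then (1 : ℝ) else 0 :=
        Finset.single_le_sum (f := fun S => ∑ H ∈ (S ×ˢ S).powersetCard (k + 1),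
          if H ⊆ E then (1 : ℝ) else 0)
          (fun S _ => Finset.sum_nonneg fun H _ => hterm S H)
          (Finset.mem_powersetCard.2 ⟨Finset.subset_univ _, hk⟩)
    _ ≤ denseSubgraphCount E :=
        Finset.single_le_sum (f := fun k => ∑ S ∈ (Finset.univ : Finset (Fin n)).powersetCard (k + 1),
          ∑ H ∈ (S ×ˢ S).powersetCard (k + 1), if H ⊆ E then (1 : ℝ) else 0)
          (fun k _ => Finset.sum_nonneg fun S _ => Finset.sum_nonneg fun H _ => hterm S H) hkn

lemma edgeExpectation_denseSubgraphCount_le {n : ℕ} {p : ℝ} (hp : 0 ≤ p)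
    (hsmall : Real.exp 2 * (n * p) ≤ 1 / 2) :
    edgeExpectation n p denseSubgraphCount ≤ 2 * (Real.exp 2 * (n * p)) := by
  set x := Real.exp 2 * (n * p)
  have hx : 0 ≤ x := by positivity
  unfold denseSubgraphCount
  rw [edgeExpectation_sum]
  calc _ ≤ ∑ k ∈ Finset.range n, x * (1 / 2) ^ k := Finset.sum_le_sum fun k _ => ?_
    _ = x * ∑ k ∈ Finset.range n, (1 / 2) ^ k := (Finset.mul_sum _ _ _).symm
    _ ≤ x * 2 := by
        gcongr
        exact (summable_geometric_two.sum_le_tsum _ fun _ _ => by positivity).trans_eq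
          tsum_geometric_two
    _ = _ := mul_comm _ _
  calc _ ≤ (n.choose (k + 1) : ℝ) * (((k + 1) * (k + 1)).choose (k + 1) * p ^ (k + 1)) := by
        rw [edgeExpectation_sum]
        refine (Finset.sum_le_card_nsmul _ _ (((k + 1) * (k + 1)).choose (k + 1) * p ^ (k + 1))
          fun S hS => ?_).trans_eq ?_
        · have hScard := (Finset.mem_powersetCard.1 hS).2
          rw [edgeExpectation_sum]
          refine (Finset.sum_le_card_nsmul _ _ (p ^ (k + 1)) fun H hH => ?_).trans_eq ?_
          · exact edgeExpectation_subset_le_pow hp fun _ => (Finset.mem_powersetCard.1 hH).2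
          · rw [Finset.card_powersetCard, Finset.card_product, hScard, nsmul_eq_mul]
        · rw [Finset.card_powersetCard, Finset.card_univ, Fintype.card_fin, nsmul_eq_mul]
    _ ≤ x ^ (k + 1) := choose_mul_choose_mul_pow_le hp n (k + 1)
    _ = x * x ^ k := pow_succ' x k
    _ ≤ _ := by gcongr

/-- If `p = o(1 / n)` then the random digraph has no `1`-cycles with high probability. -/
lemma holdsWHP_betti_eq_zero_of_sparse (F : PathFlavour) {p : ℕ → ℝ}
    (hp : ∀ n, p n ∈ Set.Icc (0 : ℝ) 1)
    (hsparse : p =o[atTop] (fun n : ℕ => (n : ℝ) ^ (-1 : ℝ))) :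
    HoldsWHP p (fun _ G => betti ℤ F G 1 = 0) := by
  have hlim : Tendsto (fun n : ℕ => (n : ℝ) * p n) atTop (𝓝 0) := by
    refine hsparse.tendsto_div_nhds_zero.congr fun n => ?_
    rw [Real.rpow_neg_one, div_inv_eq_mul, mul_comm]
  have hlim' : Tendsto (fun n : ℕ => Real.exp 2 * (n * p n)) atTop (𝓝 0) := by
    simpa using hlim.const_mul (Real.exp 2)
  refine holdsWHP_of_edgeExpectation_le hp (X := fun n => denseSubgraphCount)
    (by simpa using hlim'.const_mul 2) ?_
  filter_upwards [hlim'.eventually_le_const (by norm_num : (0 : ℝ) < 1 / 2)] with n hn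
  refine ⟨fun E hE => ⟨denseSubgraphCount_nonneg E, fun hbetti => ?_⟩,
    edgeExpectation_denseSubgraphCount_le (hp n).1 hn⟩
  have hcycles : cycles ℤ F (ofEdges E) 1 ≠ ⊥ := by
    intro h
    exact hbetti (betti_eq_zero_of_cycles_le_boundaries (h ▸ bot_le))
  obtain ⟨f, hf, hf0⟩ := Submodule.exists_mem_ne_zero_of_ne_bot hcycles
  obtain ⟨S, H, hS, hHS, hHE, hcard⟩ :=
    exists_edges_of_mem_cycles (not_adj_ofEdges_self hE) hf hf0
  exact one_le_denseSubgraphCount hS hHS hHE hcard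

/-! ### The dense regime. -/

/-- The edges from `w` to each of the three vertices of `t`. -/
def coneEdges {n : ℕ} (t : Fin n × Fin n × Fin n) (w : Fin n) : Finset (Fin n × Fin n) :=
  {(w, t.1), (w, t.2.1), (w, t.2.2)}

/-- The number of triples of vertices without a common in-neighbour outside of the triple. -/
def unconedTripleCount {n : ℕ} (E : Finset (Fin n × Fin n)) : ℝ :=
  ∑ t : Fin n × Fin n × Fin n, ∏ w ∈ Finset.univ \ {t.1, t.2.1, t.2.2},
    (1 - if coneEdges t w ⊆ E then 1 else 0)

lemma unconedTripleCount_nonneg {n : ℕ} (E : Finset (Fin n × Fin n)) :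
    0 ≤ unconedTripleCount E :=
  Finset.sum_nonneg fun _ _ => Finset.prod_nonneg fun _ _ => by split_ifs <;> norm_num

lemma one_le_unconedTripleCount {n : ℕ} {E : Finset (Fin n × Fin n)}
    (h : ¬ ∀ a b c, ∃ w, (ofEdges E).Adj w a ∧ (ofEdges E).Adj w b ∧ (ofEdges E).Adj w c) :
    1 ≤ unconedTripleCount E := by
  push Not at h
  obtain ⟨a, b, c, h⟩ := h
  refine le_of_eq_of_le (Finset.prod_eq_one (s := Finset.univ \ {a, b, c})
    fun w _ => ?_).symm (Finset.single_le_sum (f := fun t : Fin n × Fin n × Fin n =>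
      ∏ w ∈ Finset.univ \ {t.1, t.2.1, t.2.2}, (1 - if coneEdges t w ⊆ E then (1 : ℝ) else 0))
      (fun _ _ => Finset.prod_nonneg fun _ _ => by split_ifs <;> norm_num)
      (Finset.mem_univ (a, b, c)))
  rw [if_neg, sub_zero]
  intro hsub
  simp only [coneEdges, Finset.insert_subset_iff, Finset.singleton_subset_iff] at hsub
  exact h w hsub.1 hsub.2.1 hsub.2.2

/-- Different apexes use edges with different sources, so their failures are independent. Excluding
the triple avoids loops and leaves at least `n - 3` apexes; repeated vertices only make success
likelier. -/
lemma edgeExpectation_unconedTripleCount_le {n : ℕ} {p : ℝ} (hp : p ∈ Set.Icc (0 : ℝ) 1) :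
    edgeExpectation n p unconedTripleCount ≤ n ^ 3 * (1 - p ^ 3) ^ (n - 3) := by
  unfold unconedTripleCount
  have hp3 : 0 ≤ 1 - p ^ 3 := sub_nonneg.2 (pow_le_one₀ hp.1 hp.2)
  have hp3' : 1 - p ^ 3 ≤ 1 := sub_le_self _ (pow_nonneg hp.1 3)
  rw [edgeExpectation_sum]
  refine (Finset.sum_le_card_nsmul _ _ ((1 - p ^ 3) ^ (n - 3)) fun t _ => ?_).trans_eq ?_
  · rw [edgeExpectation_prod_one_sub]
    · calc _ ≤ ∏ w ∈ Finset.univ \ {t.1, t.2.1, t.2.2}, (1 - p ^ 3) := by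
            refine Finset.prod_le_prod (fun w _ => sub_nonneg.2 (pow_le_one₀ hp.1 hp.2))
              fun w _ => sub_le_sub_left (pow_le_pow_of_le_one hp.1 hp.2 Finset.card_le_three) 1
        _ = (1 - p ^ 3) ^ (Finset.univ \ {t.1, t.2.1, t.2.2} : Finset (Fin n)).card := by
            rw [Finset.prod_const]
        _ ≤ _ := by
            refine pow_le_pow_of_le_one hp3 hp3' ?_
            have h := Finset.le_card_sdiff ({t.1, t.2.1, t.2.2} : Finset (Fin n)) Finset.univ
            have h3 : ({t.1, t.2.1, t.2.2} : Finset (Fin n)).card ≤ 3 := Finset.card_le_three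
            rw [Finset.card_univ, Fintype.card_fin] at h
            omega
    · intro w hw
      simp only [Finset.mem_sdiff, Finset.mem_univ, true_and, Finset.mem_insert,
        Finset.mem_singleton, not_or] at hw
      simpa only [coneEdges, Finset.insert_subset_iff, Finset.singleton_subset_iff,
        mem_possibleEdges] using hw
    · intro w _ w' _ hww'
      rw [Function.onFun, Finset.disjoint_left]
      intro e he he'
      refine hww' ?_
      have h1 : e.1 = w := by
        simp only [coneEdges, Finset.mem_insert, Finset.mem_singleton] at he
        rcases he with rfl | rfl | rfl <;> rfl
      have h2 : e.1 = w' := by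
        simp only [coneEdges, Finset.mem_insert, Finset.mem_singleton] at he'
        rcases he' with rfl | rfl | rfl <;> rfl
      exact h1.symm.trans h2
  · simp only [Finset.card_univ, Fintype.card_prod, Fintype.card_fin, nsmul_eq_mul]
    push_cast
    ring

/-- If `p = ω((n / log n) ^ (-1/3))` then any three vertices have a common in-neighbour with high
probability, so that every `1`-cycle is a boundary. -/
lemma holdsWHP_betti_eq_zero_of_dense (F : PathFlavour) {p : ℕ → ℝ}
    (hp : ∀ n, p n ∈ Set.Icc (0 : ℝ) 1)
    (hdense : (fun n : ℕ => ((n : ℝ) / Real.log n) ^ (-(1 / 3) : ℝ)) =o[atTop] p) :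
    HoldsWHP p (fun _ G => betti ℤ F G 1 = 0) := by
  refine holdsWHP_of_edgeExpectation_le hp (X := fun n => unconedTripleCount)
    (tendsto_inv_atTop_nhds_zero_nat (𝕜 := ℝ)) ?_
  -- Cubing the constant `1 / 2` gives `p³ ≥ 8 log n / n`, and `n ≥ 6` gives `n - 3 ≥ n / 2`; the
  -- resulting factor `n⁻⁴` beats the `n³` triples.
  filter_upwards [hdense.def (by norm_num : (0 : ℝ) < 1 / 2), eventually_ge_atTop 6] with n hn h6
  have hn6 : (6 : ℝ) ≤ n := by exact_mod_cast h6
  have hn0 : (0 : ℝ) < n := by linarith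
  have hlog : 0 < Real.log n := Real.log_pos (by linarith)
  have hp0 := (hp n).1
  have hp1 := (hp n).2
  refine ⟨fun E hE => ⟨unconedTripleCount_nonneg E, fun hbetti => ?_⟩,
    (edgeExpectation_unconedTripleCount_le (hp n)).trans ?_⟩
  · refine one_le_unconedTripleCount fun hcone => hbetti ?_
    have : Nonempty (Fin n) := ⟨⟨0, by omega⟩⟩
    exact betti_eq_zero_of_cycles_le_boundaries
      (cycles_le_boundaries (not_adj_ofEdges_self hE) hcone)
  · have hcube : 8 * (Real.log n / n) ≤ p n ^ 3 := by
      have hbase : 0 < (n : ℝ) / Real.log n := by positivity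
      rw [Real.norm_of_nonneg (Real.rpow_nonneg hbase.le _), Real.norm_of_nonneg hp0] at hn
      have h := pow_le_pow_left₀ (Real.rpow_nonneg hbase.le _) hn 3
      have h' : (((n : ℝ) / Real.log n) ^ (-(1 / 3) : ℝ)) ^ 3 = Real.log n / n := by
        rw [← Real.rpow_natCast, ← Real.rpow_mul hbase.le,
          show (-(1 / 3) : ℝ) * ((3 : ℕ) : ℝ) = -1 by norm_num, Real.rpow_neg_one, inv_div]
      rw [h'] at h
      nlinarith
    have hexp : 4 * Real.log n ≤ ((n - 3 : ℕ) : ℝ) * p n ^ 3 := by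
      rw [Nat.cast_sub (by omega)]
      push_cast
      calc 4 * Real.log n = (n / 2 : ℝ) * (8 * (Real.log n / n)) := by field_simp; norm_num
        _ ≤ ((n : ℝ) - 3) * p n ^ 3 := by
            apply mul_le_mul (by linarith) hcube (by positivity) (by linarith)
    calc (n : ℝ) ^ 3 * (1 - p n ^ 3) ^ (n - 3)
        ≤ (n : ℝ) ^ 3 * (Real.exp (-(p n ^ 3))) ^ (n - 3) := by
          gcongr
          · exact sub_nonneg.2 (pow_le_one₀ hp0 hp1)
          · exact Real.one_sub_le_exp_neg _
      _ = (n : ℝ) ^ 3 * Real.exp (-(((n - 3 : ℕ) : ℝ) * p n ^ 3)) := by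
          rw [← Real.exp_nat_mul, mul_neg]
      _ ≤ (n : ℝ) ^ 3 * Real.exp (-(4 * Real.log n)) := by gcongr
      _ = (n : ℝ)⁻¹ := by
          rw [Real.exp_neg, show (4 : ℝ) * Real.log n = ((4 : ℕ) : ℝ) * Real.log n by norm_num,
            Real.exp_nat_mul, Real.exp_log hn0]
          field_simp

/-! ### The intermediate regime. -/

/-- If `p = ω(1 / n)` and `p = o(n ^ (-2/3))`, then the mean of the number of vertices and of small
cycles is negligible against the mean `n (n - 1) p` of the number of edges. -/
lemma exists_tendsto_zero_error {p : ℕ → ℝ} (hp : ∀ n, p n ∈ Set.Icc (0 : ℝ) 1)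
    (hlow : (fun n : ℕ => (n : ℝ) ^ (-1 : ℝ)) =o[atTop] p)
    (hupp : p =o[atTop] (fun n : ℕ => (n : ℝ) ^ (-(2 / 3) : ℝ))) :
    ∃ ε : ℕ → ℝ, Tendsto ε atTop (𝓝 0) ∧ ∀ᶠ n : ℕ in atTop, 0 < (n : ℝ) * (n - 1) * p n ∧
      1 ≤ ε n * (n * (n - 1) * p n) ∧
      n + (n ^ 3 * p n ^ 3 + n ^ 2 * p n ^ 2 + n ^ 4 * p n ^ 4) ≤ ε n * (n * (n - 1) * p n) := by
  -- As `n (n - 1) p ≥ n² p / 2`, the first term pays for `n`. The second equals `6 n² p³` and pays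
  -- for `3 (n p)⁴`, which bounds the three counts once `n p ≥ 1`.
  refine ⟨fun n => 2 * ((n : ℝ) ^ (-1 : ℝ) / p n) + 6 * (p n / (n : ℝ) ^ (-(2 / 3) : ℝ)) ^ 3,
    ?_, ?_⟩
  · simpa using (hlow.tendsto_div_nhds_zero.const_mul 2).add
      ((hupp.tendsto_div_nhds_zero.pow 3).const_mul 6)
  filter_upwards [hlow.def one_pos, eventually_ge_atTop 2] with n hn h2
  have hn2 : (2 : ℝ) ≤ n := by exact_mod_cast h2
  have hn0 : (0 : ℝ) < n := by linarith
  have hp0 := (hp n).1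
  rw [Real.rpow_neg_one, one_mul, Real.norm_of_nonneg (inv_nonneg.2 hn0.le),
    Real.norm_of_nonneg hp0] at hn
  have hpos : 0 < p n := (inv_pos.2 hn0).trans_le hn
  have hnp : 1 ≤ n * p n := by
    rwa [inv_le_iff_one_le_mul₀' hn0] at hn
  have hcube : (p n / (n : ℝ) ^ (-(2 / 3) : ℝ)) ^ 3 = n ^ 2 * p n ^ 3 := by
    have h : ((n : ℝ) ^ (-(2 / 3) : ℝ)) ^ 3 = ((n : ℝ) ^ 2)⁻¹ := by
      rw [← Real.rpow_natCast, ← Real.rpow_mul hn0.le,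
        show (-(2 / 3) : ℝ) * ((3 : ℕ) : ℝ) = -((2 : ℕ) : ℝ) by norm_num, Real.rpow_neg hn0.le,
        Real.rpow_natCast]
    rw [div_pow, h, div_inv_eq_mul, mul_comm]
  have hμ : (n : ℝ) ^ 2 * p n / 2 ≤ n * (n - 1) * p n := by
    have : (n : ℝ) ^ 2 / 2 ≤ n * (n - 1) := by nlinarith
    calc (n : ℝ) ^ 2 * p n / 2 = (n : ℝ) ^ 2 / 2 * p n := by ring
      _ ≤ _ := by gcongr
  have hfirst : (n : ℝ) ≤ 2 * ((n : ℝ) ^ (-1 : ℝ) / p n) * (n * (n - 1) * p n) := by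
    calc (n : ℝ) = 2 * ((n : ℝ) ^ (-1 : ℝ) / p n) * ((n : ℝ) ^ 2 * p n / 2) := by
          rw [Real.rpow_neg_one]
          field_simp
      _ ≤ _ := by gcongr
  have hsecond : 3 * ((n : ℝ) * p n) ^ 4 ≤ 6 * (n ^ 2 * p n ^ 3) * (n * (n - 1) * p n) := by
    calc 3 * ((n : ℝ) * p n) ^ 4 = 6 * (n ^ 2 * p n ^ 3) * ((n : ℝ) ^ 2 * p n / 2) := by ring
      _ ≤ _ := by gcongr
  have h3 : (n * p n) ^ 3 ≤ (n * p n) ^ 4 := pow_le_pow_right₀ hnp (by norm_num)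
  have h2' : (n * p n) ^ 2 ≤ (n * p n) ^ 4 := pow_le_pow_right₀ hnp (by norm_num)
  have h4 : 0 ≤ (n * p n) ^ 4 := by positivity
  rw [hcube, add_mul, ← mul_pow, ← mul_pow, ← mul_pow]
  exact ⟨lt_of_lt_of_le (by positivity) hμ, by linarith, by linarith⟩

lemma edgeExpectation_card_sub_betti_le (F : PathFlavour) (n : ℕ) {p : ℝ}
    (hp : p ∈ Set.Icc (0 : ℝ) 1) :
    edgeExpectation n p (fun E => (E.card : ℝ) - betti ℤ F (ofEdges E) 1) ≤
      n + (n ^ 3 * p ^ 3 + n ^ 2 * p ^ 2 + n ^ 4 * p ^ 4) := by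
  refine (edgeExpectation_mono hp fun E hE => card_sub_betti_le F hE).trans ?_
  rw [edgeExpectation_add, edgeExpectation_const]
  exact add_le_add_right (edgeExpectation_smallCycleCount_le hp.1) _

/-- In the intermediate regime the first Betti number has the same asymptotic mean as the number of
edges. -/
lemma tendsto_expectation_betti_div (F : PathFlavour) {p : ℕ → ℝ}
    (hp : ∀ n, p n ∈ Set.Icc (0 : ℝ) 1)
    (hlow : (fun n : ℕ => (n : ℝ) ^ (-1 : ℝ)) =o[atTop] p)
    (hupp : p =o[atTop] (fun n : ℕ => (n : ℝ) ^ (-(2 / 3) : ℝ))) :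
    Tendsto (fun n : ℕ => expectation n (p n) (fun G => (betti ℤ F G 1 : ℝ)) /
      ((n : ℝ) * ((n : ℝ) - 1) * p n)) atTop (𝓝 1) := by
  obtain ⟨ε, hε, hev⟩ := exists_tendsto_zero_error hp hlow hupp
  have hlower : Tendsto (fun n => 1 - ε n) atTop (𝓝 1) := by simpa using hε.const_sub 1
  refine tendsto_of_tendsto_of_tendsto_of_le_of_le' hlower tendsto_const_nhds ?_ ?_
  · filter_upwards [hev] with n ⟨hμ, _, hn⟩
    have h := edgeExpectation_card_sub_betti_le F n (hp n)
    rw [edgeExpectation_sub, edgeExpectation_card] at h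
    rw [le_div_iff₀ hμ, expectation_eq_edgeExpectation]
    linarith
  · filter_upwards [hev] with n ⟨hμ, _, _⟩
    rw [div_le_one hμ, expectation_eq_edgeExpectation, ← edgeExpectation_card]
    exact edgeExpectation_mono (hp n) fun E _ => Nat.cast_le.2 (betti_le_card F E)

/-- In the intermediate regime the first Betti number is positive with high probability. -/
lemma holdsWHP_betti_pos (F : PathFlavour) {p : ℕ → ℝ}
    (hp : ∀ n, p n ∈ Set.Icc (0 : ℝ) 1)
    (hlow : (fun n : ℕ => (n : ℝ) ^ (-1 : ℝ)) =o[atTop] p)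
    (hupp : p =o[atTop] (fun n : ℕ => (n : ℝ) ^ (-(2 / 3) : ℝ))) :
    HoldsWHP p (fun _ G => 0 < betti ℤ F G 1) := by
  obtain ⟨ε, hε, hev⟩ := exists_tendsto_zero_error hp hlow hupp
  -- Markov for `|E| - β₁` and Chebyshev for `|E|` in one function: if `β₁ = 0` and `t = |E| / μ`,
  -- where `μ` is the mean of `|E|`, it equals `2t + 4(t - 1)² = (2t - 3/2)² + 7/4`.
  refine holdsWHP_of_edgeExpectation_le hp (δ := fun n => 6 * ε n)
    (X := fun n E => 2 / (n * (n - 1) * p n) * ((E.card : ℝ) - betti ℤ F (ofEdges E) 1) +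
      4 / (n * (n - 1) * p n) ^ 2 * ((E.card : ℝ) - n * (n - 1) * p n) ^ 2)
    (by simpa using hε.const_mul 6) ?_
  filter_upwards [hev] with n ⟨hμ, hone, hn⟩
  have hvar := edgeExpectation_card_sub_sq_le n (hp n)
  have hmean := (edgeExpectation_card_sub_betti_le F n (hp n)).trans hn
  refine ⟨fun E hE => ?_, ?_⟩
  · have hbetti : (betti ℤ F (ofEdges E) 1 : ℝ) ≤ E.card := Nat.cast_le.2 (betti_le_card F E)
    refine ⟨add_nonneg (mul_nonneg (by positivity) (sub_nonneg.2 hbetti)) (by positivity), ?_⟩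
    intro hzero
    generalize (n : ℝ) * (n - 1) * p n = μ at hμ
    rw [Nat.eq_zero_of_not_pos hzero, Nat.cast_zero, sub_zero]
    have hid : 2 / μ * (E.card : ℝ) + 4 / μ ^ 2 * ((E.card : ℝ) - μ) ^ 2 =
        1 + (2 * (E.card : ℝ) / μ - 3 / 2) ^ 2 + 3 / 4 := by
      field_simp
      ring
    rw [hid]
    nlinarith [sq_nonneg (2 * (E.card : ℝ) / μ - 3 / 2)]
  · rw [edgeExpectation_add, edgeExpectation_const_mul, edgeExpectation_const_mul]
    generalize (n : ℝ) * (n - 1) * p n = μ at hμ hone hn hvar hmean ⊢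
    calc _ ≤ 2 / μ * (ε n * μ) + 4 / μ ^ 2 * μ := by gcongr
      _ = 2 * ε n + 4 / μ := by field_simp
      _ ≤ 2 * ε n + 4 * ε n := by
          gcongr
          rw [div_le_iff₀ hμ]
          linarith
      _ = _ := by ring

/-! ### Power laws as special cases. -/

lemma rpow_natCast_mem_Icc {α : ℝ} (hα : α ≤ 0) (n : ℕ) : (n : ℝ) ^ α ∈ Set.Icc (0 : ℝ) 1 := by
  refine ⟨by positivity, ?_⟩
  rcases n.eq_zero_or_pos with rfl | hn
  · rcases eq_or_ne α 0 with rfl | h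
    · simp
    · simp [Real.zero_rpow h]
  · exact Real.rpow_le_one_of_one_le_of_nonpos (by exact_mod_cast hn) hα

lemma isLittleO_rpow_natCast {α β : ℝ} (h : α < β) :
    (fun n : ℕ => (n : ℝ) ^ α) =o[atTop] (fun n : ℕ => (n : ℝ) ^ β) := by
  have hpos : ∀ᶠ n : ℕ in atTop, (0 : ℝ) < n := by
    filter_upwards [eventually_gt_atTop 0] with n hn using by exact_mod_cast hn
  refine isLittleO_of_tendsto' ?_ ?_
  · filter_upwards [hpos] with n hn h0
    exact absurd h0 (Real.rpow_pos_of_pos hn β).ne'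
  · refine ((tendsto_rpow_neg_atTop (sub_pos.2 h)).comp tendsto_natCast_atTop_atTop).congr' ?_
    filter_upwards [hpos] with n hn
    rw [Function.comp, neg_sub, Real.rpow_sub hn]

/-- The left side is `n^(-1/3) (log n)^(1/3)`, and the logarithmic factor is `o(n^(α + 1/3))`. -/
lemma isLittleO_div_log_rpow {α : ℝ} (h : -(1 / 3) < α) :
    (fun n : ℕ => ((n : ℝ) / Real.log n) ^ (-(1 / 3) : ℝ)) =o[atTop]
      (fun n : ℕ => (n : ℝ) ^ α) := by
  have hlog := (isLittleO_log_rpow_rpow_atTop (1 / 3) (by linarith : 0 < α + 1 / 3)).comp_tendsto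
    tendsto_natCast_atTop_atTop
  have h := (isBigO_refl (fun n : ℕ => (n : ℝ) ^ (-(1 / 3) : ℝ)) atTop).mul_isLittleO hlog
  refine h.congr' ?_ ?_
  · filter_upwards [eventually_ge_atTop 2] with n hn
    have hn' : (1 : ℝ) < n := by exact_mod_cast hn
    have hl := Real.log_pos hn'
    rw [Real.div_rpow (by positivity) hl.le, Real.rpow_neg hl.le, div_inv_eq_mul]
    rfl
  · filter_upwards [eventually_ge_atTop 1] with n hn
    have hn' : (0 : ℝ) < n := by exact_mod_cast hn
    simp only [Function.comp]
    rw [← Real.rpow_add hn']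
    congr 1
    ring

end RandomDigraph

end

theorem theorem1p3 (F : PathFlavour) :
    -- power laws `p = n ^ α`
    (∀ α : ℝ, -1 < α → α < -(2 / 3) →
      Tendsto (fun n : ℕ =>
        RandomDigraph.expectation n ((n : ℝ) ^ α) (fun G => (PathHomology.betti ℤ F G 1 : ℝ)) /
          ((n : ℝ) * ((n : ℝ) - 1) * (n : ℝ) ^ α)) atTop (𝓝 1)) ∧
    (∀ α : ℝ, -1 < α → α < -(2 / 3) →
      RandomDigraph.HoldsWHP (fun n => (n : ℝ) ^ α)
        (fun _ G => 0 < PathHomology.betti ℤ F G 1)) ∧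
    (∀ α : ℝ, α < -1 →
      RandomDigraph.HoldsWHP (fun n => (n : ℝ) ^ α)
        (fun _ G => PathHomology.betti ℤ F G 1 = 0)) ∧
    (∀ α : ℝ, -(1 / 3) < α → α ≤ 0 →
      RandomDigraph.HoldsWHP (fun n => (n : ℝ) ^ α)
        (fun _ G => PathHomology.betti ℤ F G 1 = 0)) ∧
    -- general edge probabilities `p = p n`
    (∀ p : ℕ → ℝ, (∀ n, p n ∈ Set.Icc (0 : ℝ) 1) →
      ((fun n : ℕ => (n : ℝ) ^ (-1 : ℝ)) =o[atTop] p →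
        p =o[atTop] (fun n : ℕ => (n : ℝ) ^ (-(2 / 3) : ℝ)) →
        Tendsto (fun n : ℕ =>
          RandomDigraph.expectation n (p n) (fun G => (PathHomology.betti ℤ F G 1 : ℝ)) /
            ((n : ℝ) * ((n : ℝ) - 1) * p n)) atTop (𝓝 1) ∧
        RandomDigraph.HoldsWHP p (fun _ G => 0 < PathHomology.betti ℤ F G 1)) ∧
      (p =o[atTop] (fun n : ℕ => (n : ℝ) ^ (-1 : ℝ)) →
        RandomDigraph.HoldsWHP p (fun _ G => PathHomology.betti ℤ F G 1 = 0)) ∧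
      ((fun n : ℕ => ((n : ℝ) / Real.log n) ^ (-(1 / 3) : ℝ)) =o[atTop] p →
        RandomDigraph.HoldsWHP p (fun _ G => PathHomology.betti ℤ F G 1 = 0))) := by
  have hlow : ∀ α : ℝ, -1 < α → (fun n : ℕ => (n : ℝ) ^ (-1 : ℝ)) =o[atTop]
      fun n : ℕ => (n : ℝ) ^ α := fun α h => RandomDigraph.isLittleO_rpow_natCast h
  refine ⟨fun α h1 h2 => ?_, fun α h1 h2 => ?_, fun α h => ?_, fun α h1 h2 => ?_,
    fun p hp => ⟨fun h1 h2 => ?_, fun h => ?_, fun h => ?_⟩⟩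
  · exact RandomDigraph.tendsto_expectation_betti_div F
      (RandomDigraph.rpow_natCast_mem_Icc (by linarith)) (hlow α h1)
      (RandomDigraph.isLittleO_rpow_natCast h2)
  · exact RandomDigraph.holdsWHP_betti_pos F
      (RandomDigraph.rpow_natCast_mem_Icc (by linarith)) (hlow α h1)
      (RandomDigraph.isLittleO_rpow_natCast h2)
  · exact RandomDigraph.holdsWHP_betti_eq_zero_of_sparse F
      (RandomDigraph.rpow_natCast_mem_Icc (by linarith)) (RandomDigraph.isLittleO_rpow_natCast h)
  · exact RandomDigraph.holdsWHP_betti_eq_zero_of_dense F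
      (RandomDigraph.rpow_natCast_mem_Icc h2) (RandomDigraph.isLittleO_div_log_rpow h1)
  · exact ⟨RandomDigraph.tendsto_expectation_betti_div F hp h1 h2,
      RandomDigraph.holdsWHP_betti_pos F hp h1 h2⟩
  · exact RandomDigraph.holdsWHP_betti_eq_zero_of_sparse F hp h
  · exact RandomDigraph.holdsWHP_betti_eq_zero_of_dense F hp h
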